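/- Let $N\ge 3$ and let $\mathcal A_N$ be the complex Lie algebra generated by letters $e_i$, $i\in\mathbb Z/N\mathbb Z$, subject to the generalized Dolan–Grady relations $[e_i,[e_i,e_j]]=e_j$ if $j=i\pm1$, and $[e_i,e_j]=0$ if $j\neq i\pm 1$. In any Lie algebra containing elements $e_i$ ($i\in\mathbb Z/N\mathbb Z$) define the strings $S_i(r)=[e_i,[e_{i+1},[\dots,[e_{i+r-2},e_{i+r-1}]\dots]]]$ for $r\ge1$ (so $S_i(1)=e_i$). For constants $k_i\in\mathbb C$, $i\in\mathbb Z/N\mathbb Z$, put $$I_0=H=\sum_{i} k_i e_i,\qquad I_m=\sum_{i} k_i\bigl(S_i(Nm+1)+2S_{i+1}(Nm-1)\bigr)\quad(m\ge1).$$ Then: 1. $[I_m,I_n]=0$ in $\mathcal A_N$ for all $m,n\ge0$. 2. For every complex vector space $V$ and all linear operators $e_i$ ($i\in\mathbb Z/N\mathbb Z$) on $V$ satisfying the generalized Dolan–Grady relations (with the commutator as bracket), the operators $I_m$ built from them by the same formulas satisfy $[I_m,I_n]=0$ for all $m,n\ge0$. 3. If the constants $k_i$ are not all zero, then the elements $I_m$,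 $m\ge0$, of $\mathcal A_N$ are linearly independent over $\mathbb C$. -/

import Mathlib

namespace SlOnsager

/-- Adjacency in the Dynkin graph of type `A_{N-1}^{(1)}` (a cycle with `N` vertices, `N ≥ 3`),
whose vertices are labelled cyclically by `ZMod N`. -/
def Adjacent {N : ℕ} (i j : ZMod N) : Prop := j = i + 1 ∨ i = j + 1

/-- The generalized Dolan-Grady relations for a family `e` of elements of a Lie algebra. -/
structure DolanGrady {N : ℕ} {L : Type*} [LieRing L] (e : ZMod N → L) : Prop where
  adjacent : ∀ i j, Adjacent i j → ⁅e i, ⁅e i, e j⁆⁆ = e j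
  not_adjacent : ∀ i j, ¬ Adjacent i j → ⁅e i, e j⁆ = 0

/-- The letters, inside the free complex Lie algebra on them. -/
noncomputable def letter {N : ℕ} (i : ZMod N) : FreeLieAlgebra ℂ (ZMod N) :=
  FreeLieAlgebra.of ℂ i

/-- The differences of the two sides of the defining relations, in the free Lie algebra. -/
def relators (N : ℕ) : Set (FreeLieAlgebra ℂ (ZMod N)) :=
  {x | ∃ i j : ZMod N, Adjacent i j ∧ x = ⁅letter i, ⁅letter i, letter j⁆⁆ - letter j} ∪
  {x | ∃ i j : ZMod N, ¬ Adjacent i j ∧ x = ⁅letter i, letter j⁆}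

/-- The Lie ideal generated by the defining relations. -/
noncomputable def relationIdeal (N : ℕ) : LieIdeal ℂ (FreeLieAlgebra ℂ (ZMod N)) :=
  LieSubmodule.lieSpan ℂ (FreeLieAlgebra ℂ (ZMod N)) (relators N)

/-- The `sl(N)` Onsager algebra `A_N`: the complex Lie algebra generated by letters `e_i`
subject to the generalized Dolan-Grady relations. -/
abbrev OnsagerAlgebra (N : ℕ) : Type :=
  FreeLieAlgebra ℂ (ZMod N) ⧸ relationIdeal N

/-- The generators `e_i` of `A_N`. -/
noncomputable def gen {N : ℕ} (i : ZMod N) : OnsagerAlgebra N :=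
  LieSubmodule.Quotient.mk (letter i)

/-- The string `S_i(r) = [e_i, [e_{i+1}, [..., e_{i+r-1}]...]]` of length `r`;
the string of length `0` is zero. -/
def strand {N : ℕ} {L : Type*} [LieRing L] (e : ZMod N → L) : ZMod N → ℕ → L
  | _, 0 => 0
  | i, 1 => e i
  | i, r + 2 => ⁅e i, strand e (i + 1) (r + 1)⁆

/-- The Hamiltonian `H = ∑ k_i e_i`. -/
noncomputable def hamiltonian {N : ℕ} [NeZero N] {L : Type*} [LieRing L] [LieAlgebra ℂ L]
    (e : ZMod N → L) (k : ZMod N → ℂ) : L :=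
  ∑ i, k i • e i

/-- `I_0 = H` and `I_m = ∑ k_i (S_i(Nm+1) + 2 S_{i+1}(Nm-1))` for `m ≥ 1`. -/
noncomputable def integral {N : ℕ} [NeZero N] {L : Type*} [LieRing L] [LieAlgebra ℂ L]
    (e : ZMod N → L) (k : ZMod N → ℂ) (m : ℕ) : L :=
  if m = 0 then hamiltonian e k
  else ∑ i, k i • (strand e i (N * m + 1) + (2 : ℂ) • strand e (i + 1) (N * m - 1))

end SlOnsager

-- The bracket of linear operators is their commutator.
attribute [local instance 100] LieRing.ofAssociativeRing

/-!
Write `X_{a,b} = E_{a,b} - (-1) ^ (b - a) E_{b,a}` for integers `a < b`, in matrices whose rows and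
columns are labelled by `ℤ` and which are periodic with period `N`. The segment `seg e i r` is the
abstract counterpart of `X_{i,i+r}` or, if `N ∣ r`, of the difference `X_{i,i+r} - X_{i+1,i+r+1}`,
which is all that the generators reach. The Dolan-Grady relations determine the brackets of the
generators with the segments, so the segments span.

As a periodic matrix is the same as a loop, `A_N` maps to matrices over `ℂ[T;T⁻¹]`, and comparing
coefficients shows that only the multiples of the elements `z_n = ∑ b, seg e b n` with `N ∣ n` can
die. These are central, so the brackets of segments are known up to central elements, and by the
Jacobi identity the sum over `i` of `⁅seg e i s, seg e (i + s) (n - s)⁆` is additive in `s`, hence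
equal to `s • z_n`. Exchanging the two factors gives `(n - 1) • z_n = -z_n`, so `z_n = 0` and `A_N`
embeds into the loop matrices. There a string winds around the cycle by multiplication with scalars,
so that `I_m = P_m(u) • H` for the scalar `u = T ^ N + (-1) ^ N T ^ (-N)` and a polynomial `P_m` of
degree `m`; such elements commute, and they are independent because `u` is transcendental.
-/

namespace SlOnsager

open scoped LaurentPolynomial Polynomial
open LaurentPolynomial (T)

section LieIdentities

variable {L : Type*} [LieRing L]

theorem lie_lie_lie_eq_add (a b x : L) :
    ⁅a, ⁅a, ⁅b, x⁆⁆⁆ = ⁅⁅a, ⁅a, b⁆⁆, x⁆ + 2 • ⁅⁅a, b⁆, ⁅a, x⁆⁆ + ⁅b, ⁅a, ⁅a, x⁆⁆⁆ := by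
  simp only [lie_lie, lie_sub]
  abel

theorem lie_lie_lie_of_lie_lie_eq_self {a b v : L} (ha : ⁅b, ⁅b, a⁆⁆ = a)
    (hv : ⁅b, ⁅b, v⁆⁆ = v) : ⁅b, ⁅b, ⁅a, v⁆⁆⁆ = 2 • ⁅b, ⁅a, ⁅b, v⁆⁆⁆ := by
  rw [lie_lie_lie_eq_add, ha, hv, leibniz_lie b a ⁅b, v⁆, hv]
  abel

theorem lie_lie_lie_lie_of_lie_lie_eq_self {a b v : L} (ha : ⁅b, ⁅b, a⁆⁆ = a)
    (hv : ⁅b, ⁅b, v⁆⁆ = v) : ⁅b, ⁅b, ⁅b, ⁅a, v⁆⁆⁆⁆ = 4 • ⁅b, ⁅a, v⁆⁆ := by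
  rw [lie_lie_lie_of_lie_lie_eq_self ha hv, lie_nsmul,
    lie_lie_lie_of_lie_lie_eq_self ha (by rw [hv]), hv, ← mul_nsmul]

variable [IsAddTorsionFree L]

theorem lie_lie_lie_eq_zero {a b z : L} (hb : ⁅b, ⁅b, a⁆⁆ = a) (haz : ⁅a, z⁆ = 0)
    (hbz : ⁅b, ⁅b, z⁆⁆ = z) : ⁅b, ⁅a, ⁅b, z⁆⁆⁆ = 0 := by
  have h := lie_lie_lie_of_lie_lie_eq_self hb hbz
  rw [haz, lie_zero, lie_zero] at h
  simpa using h.symm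

theorem lie_lie_eq_self_of_winding {a b d w w' : L} (hab : ⁅a, ⁅a, b⁆⁆ = b) (hb : ⁅b, d⁆ = w')
    (ha : ⁅a, d⁆ = -(2 • w)) (haw : ⁅a, w⁆ = -(2 • d)) (haw' : ⁅a, w'⁆ = -⁅b, w⁆) :
    ⁅a, ⁅a, w'⁆⁆ = w' := by
  have h := lie_lie_lie_eq_add a b d
  rw [hab, hb, ha, lie_neg, lie_nsmul, lie_neg, lie_nsmul, haw, lie_neg, lie_nsmul, lie_lie a b w,
    haw, lie_neg, lie_nsmul, hb] at h
  rw [haw', lie_neg] at h ⊢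
  refine nsmul_right_injective three_ne_zero ?_
  linear_combination (norm := module) -h

theorem lie_eq_neg_lie_of_winding {a b v d d' w w' : L} (hab : ⁅a, ⁅a, b⁆⁆ = b)
    (hba : ⁅b, ⁅b, a⁆⁆ = a) (hav : ⁅a, ⁅a, v⁆⁆ = v) (hbv : ⁅b, ⁅b, v⁆⁆ = v)
    (hd : ⁅a, ⁅b, v⁆⁆ = d) (hd' : ⁅b, ⁅a, v⁆⁆ = -d') (had : ⁅a, d⁆ = -(2 • w))
    (hbd : ⁅b, d⁆ = w') (hbd' : ⁅b, d'⁆ = -(2 • w')) :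
    ⁅b, w⁆ = -⁅a, w'⁆ := by
  have bracket_by_leibniz : ⁅⁅a, b⁆, d⁆ = ⁅a, w'⁆ + 2 • ⁅b, w⁆ := by
    rw [lie_lie, hbd, had, lie_neg, lie_nsmul, sub_neg_eq_add]
  have bracket_by_expansion : ⁅⁅a, b⁆, d⁆ = -⁅a, w'⁆ := by
    have hx : ⁅⁅a, b⁆, v⁆ = d + d' := by rw [lie_lie, hd, hd', sub_neg_eq_add]
    have ha : ⁅⁅a, b⁆, a⁆ = -b := by rw [← lie_skew, hab]
    have hb : ⁅⁅a, b⁆, b⁆ = a := by rw [← lie_skew, ← lie_skew a b, lie_neg, neg_neg, hba]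
    rw [← hd, leibniz_lie ⁅a, b⁆, leibniz_lie ⁅a, b⁆ b v, ha, hb, neg_lie, hbv, hx, lie_add, hav,
      lie_add, hbd, hbd', lie_add, lie_neg, lie_nsmul]
    abel
  refine nsmul_right_injective two_ne_zero ?_
  linear_combination (norm := module) bracket_by_expansion - bracket_by_leibniz

end LieIdentities

section Residues

variable {N : ℕ}

theorem natCast_ne_zero_of_lt {s : ℕ} (h0 : 0 < s) (h1 : s < N) : (s : ZMod N) ≠ 0 := by
  rw [Ne, ZMod.natCast_eq_zero_iff]
  exact Nat.not_dvd_of_pos_of_lt h0 h1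

theorem add_one_ne_self (hN : 3 ≤ N) (i : ZMod N) : i + 1 ≠ i := by
  simpa using natCast_ne_zero_of_lt (N := N) (s := 1) one_pos (by omega)

theorem add_one_add_one_ne_self (hN : 3 ≤ N) (i : ZMod N) : i + 1 + 1 ≠ i := by
  simpa [add_assoc, one_add_one_eq_two] using
    natCast_ne_zero_of_lt (N := N) (s := 2) two_pos (by omega)

theorem eq_zero_or_exists_eq_add_three (hN : 3 ≤ N) {n : ℕ} (h : (n : ZMod N) = 0) :
    n = 0 ∨ ∃ p, n = p + 3 := by
  rcases n with _ | n
  · exact .inl rfl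
  · rw [ZMod.natCast_eq_zero_iff] at h
    have := Nat.le_of_dvd n.succ_pos h
    exact .inr ⟨n - 2, by omega⟩

theorem exists_eq_add_two (hN : 3 ≤ N) {n : ℕ} (h : (n : ZMod N) + 1 = 0) :
    ∃ l, n = l + 2 := by
  rcases eq_zero_or_exists_eq_add_three hN (n := n + 1) (by exact_mod_cast h) with h | ⟨l, h⟩
  · omega
  · exact ⟨l, by omega⟩

end Residues

section Segments

variable {N : ℕ} {L : Type*} [LieRing L]

/-- In the loop realization, with `X_{a,b} = E_{a,b} - (-1) ^ (b - a) E_{b,a}` and `E` periodic in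
`(a, b)`, the segment `seg e i r` is `X_{i,i+r}` if `N ∤ r` and `X_{i,i+r} - X_{i+1,i+r+1}` if
`N ∣ r`. The correction term in the recursion accounts for passing a multiple of `N`. -/
def seg (e : ZMod N → L) : ZMod N → ℕ → L
  | _, 0 => 0
  | i, 1 => e i
  | i, r + 2 => ⁅e i, seg e (i + 1) (r + 1)⁆ + if N ∣ r + 1 then seg e (i + 1) r else 0

variable {e : ZMod N → L}

@[simp]
theorem seg_zero (i : ZMod N) : seg e i 0 = 0 := by rw [seg]

@[simp]
theorem seg_one (i : ZMod N) : seg e i 1 = e i := by rw [seg]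

theorem seg_add_two_of_ne {n : ℕ} (h : (n : ZMod N) + 1 ≠ 0) (i : ZMod N) :
    seg e i (n + 2) = ⁅e i, seg e (i + 1) (n + 1)⁆ := by
  rw [seg, if_neg, add_zero]
  rwa [← ZMod.natCast_eq_zero_iff, Nat.cast_add_one]

theorem seg_add_two_of_eq {n : ℕ} (h : (n : ZMod N) + 1 = 0) (i : ZMod N) :
    seg e i (n + 2) = ⁅e i, seg e (i + 1) (n + 1)⁆ + seg e (i + 1) n := by
  rw [seg, if_pos]
  rwa [← ZMod.natCast_eq_zero_iff, Nat.cast_add_one]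

namespace DolanGrady

theorem lie_lie_next (he : DolanGrady e) (i : ZMod N) : ⁅e i, ⁅e i, e (i + 1)⁆⁆ = e (i + 1) :=
  he.adjacent _ _ (.inl rfl)

theorem lie_lie_prev (he : DolanGrady e) (i : ZMod N) : ⁅e (i + 1), ⁅e (i + 1), e i⁆⁆ = e i :=
  he.adjacent _ _ (.inr rfl)

theorem lie_eq_zero (he : DolanGrady e) {i j : ZMod N} (hj : j ≠ i + 1) (hi : i ≠ j + 1) :
    ⁅e i, e j⁆ = 0 :=
  he.not_adjacent _ _ (by simp [Adjacent, hj, hi])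

theorem lie_lie_comm (he : DolanGrady e) {i j : ZMod N} (hj : j ≠ i + 1) (hi : i ≠ j + 1)
    (x : L) : ⁅e i, ⁅e j, x⁆⁆ = ⁅e j, ⁅e i, x⁆⁆ := by
  rw [leibniz_lie, he.lie_eq_zero hj hi, zero_lie, zero_add]

end DolanGrady

variable (e) in
/-- The brackets of the generators with the segments `seg e i (n + 1)`: if `N ∤ n + 1`, those with
the generators at (or next to) the two ends of the segment, and `0` for the other generators; if
`N ∣ n + 1`, those of a segment winding around the cycle, in terms of the elements
`⁅e i, seg e (i + 1) (n + 1)⁆`. -/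
structure SegBrackets (n : ℕ) : Prop where
  first : (n : ZMod N) + 1 ≠ 0 → (n : ZMod N) ≠ 0 → ∀ i, ⁅e i, seg e i (n + 1)⁆ = seg e (i + 1) n
  last : (n : ZMod N) + 1 ≠ 0 → (n : ZMod N) ≠ 0 → ∀ i j : ZMod N, j = i + n →
    ⁅e j, seg e i (n + 1)⁆ = -seg e i n
  first_last : (n : ZMod N) = 0 → ∀ i, ⁅e i, seg e i (n + 1)⁆ = -seg e i n
  next : (n : ZMod N) + 1 ≠ 0 → (n : ZMod N) + 2 ≠ 0 → ∀ i j : ZMod N, j = i + n + 1 →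
    ⁅e j, seg e i (n + 1)⁆ = -seg e i (n + 2)
  apart : (n : ZMod N) + 1 ≠ 0 → ∀ i j : ZMod N, j + 1 ≠ i → j ≠ i → j ≠ i + n → j ≠ i + n + 1 →
    ⁅e j, seg e i (n + 1)⁆ = 0
  winding_self : (n : ZMod N) + 1 = 0 → ∀ i : ZMod N,
    ⁅e i, seg e i (n + 1)⁆ = -(2 • ⁅e i, seg e (i + 1) (n + 1)⁆)
  winding_next : (n : ZMod N) + 1 = 0 → ∀ i : ZMod N,
    ⁅e (i + 1), seg e i (n + 1)⁆ = ⁅e (i + 1), seg e (i + 1 + 1) (n + 1)⁆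
  winding_apart : (n : ZMod N) + 1 = 0 → ∀ i j : ZMod N, j + 1 ≠ i → j ≠ i → j ≠ i + 1 →
    ⁅e j, seg e i (n + 1)⁆ = 0

theorem segBrackets_zero (hN : 3 ≤ N) (he : DolanGrady e) : SegBrackets e 0 := by
  have one_ne : ((0 : ℕ) : ZMod N) + 1 ≠ 0 := by
    simpa using add_one_ne_self hN 0
  refine ⟨fun _ h => (h Nat.cast_zero).elim, fun _ h => (h Nat.cast_zero).elim, ?_, ?_, ?_,
    fun h => (one_ne h).elim, fun h => (one_ne h).elim, fun h => (one_ne h).elim⟩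
  · intro _ i
    simp
  · rintro _ _ i j rfl
    simp [seg_add_two_of_ne one_ne]
  · intro _ i j hj _ _ hi
    rw [zero_add, seg_one]
    exact he.lie_eq_zero (Ne.symm hj) (by simpa using hi)

section Step

variable {n : ℕ} (hN : 3 ≤ N) (H : ∀ k ≤ n, SegBrackets e k)
include hN H

theorem lie_lie_winding {p : ℕ} (hp : p + 3 ≤ n) (h : (p : ZMod N) + 3 = 0) (i : ZMod N) :
    ⁅e i, ⁅e i, seg e (i + 1) (p + 3)⁆⁆ = -(2 • seg e i (p + 3)) ∧
    ⁅e i, ⁅e (i + 1), seg e (i + 1 + 1) (p + 3)⁆⁆ = -⁅e (i + 1), ⁅e i, seg e (i + 1) (p + 3)⁆⁆ := by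
  have add_one_ne := add_one_ne_self hN
  have add_two_ne := add_one_add_one_ne_self hN
  have winding_eq (j : ZMod N) :
      ⁅e j, seg e (j + 1) (p + 3)⁆ = seg e j (p + 4) - seg e (j + 1) (p + 2) := by
    rw [seg_add_two_of_eq (n := p + 2) (by push_cast; grind), add_sub_cancel_right]
  have prepend_short : ⁅e i, seg e (i + 1) (p + 2)⁆ = seg e i (p + 3) :=
    (seg_add_two_of_ne (n := p + 1) (by push_cast; grind) i).symm
  have self_long : ⁅e i, seg e i (p + 4)⁆ = -seg e i (p + 3) :=
    (H (p + 3) hp).first_last (by push_cast; grind) i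
  have prepend_long : ⁅e i, seg e (i + 1) (p + 4)⁆ = seg e i (p + 5) :=
    (seg_add_two_of_ne (n := p + 3) (by push_cast; grind) i).symm
  have next_long : ⁅e (i + 1), seg e i (p + 4)⁆ = -seg e i (p + 5) :=
    (H (p + 3) hp).next (by push_cast; grind) (by push_cast; grind) _ _ (by push_cast; grind)
  have last_short : ⁅e i, seg e (i + 1 + 1) (p + 2)⁆ = -seg e (i + 1 + 1) (p + 1) :=
    (H (p + 1) (by omega)).last (by push_cast; grind) (by push_cast; grind) _ _
      (by push_cast; grind)
  have first_short : ⁅e (i + 1), seg e (i + 1) (p + 2)⁆ = seg e (i + 1 + 1) (p + 1) :=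
    (H (p + 1) (by omega)).first (by push_cast; grind) (by push_cast; grind) _
  simp only [winding_eq, lie_sub]
  constructor
  · rw [prepend_short, self_long]; abel
  · rw [prepend_long, next_long, last_short, first_short]; abel

variable (he : DolanGrady e) [IsAddTorsionFree L]
include he

theorem lie_lie_winding_eq_self {p : ℕ} (hp : p + 3 ≤ n) (h : (p : ZMod N) + 3 = 0)
    (i : ZMod N) :
    ⁅e i, ⁅e i, ⁅e (i + 1), seg e (i + 1 + 1) (p + 3)⁆⁆⁆ =
      ⁅e (i + 1), seg e (i + 1 + 1) (p + 3)⁆ ∧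
    ⁅e (i + 1), ⁅e (i + 1), ⁅e i, seg e (i + 1) (p + 3)⁆⁆⁆ = ⁅e i, seg e (i + 1) (p + 3)⁆ := by
  have length_eq : ((p + 2 : ℕ) : ZMod N) + 1 = 0 := by push_cast; grind
  obtain ⟨winding_twice, winding_swap⟩ := lie_lie_winding hN H hp h i
  have winding_self := (H (p + 2) (by omega)).winding_self length_eq
  have winding_next := (H (p + 2) (by omega)).winding_next length_eq
  constructor
  · exact lie_lie_eq_self_of_winding (he.lie_lie_next i) (winding_next i)
      (winding_self i) winding_twice winding_swap
  · exact lie_lie_eq_self_of_winding (he.lie_lie_prev i) rfl (winding_self (i + 1))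
      (lie_lie_winding hN H hp h (i + 1)).1 (by rw [winding_swap, neg_neg])

theorem lie_lie_seg_prev (h1 : (n : ZMod N) + 1 ≠ 0) (h2 : (n : ZMod N) + 2 ≠ 0) (i : ZMod N) :
    ⁅e i, ⁅e i, seg e (i + 1) (n + 1)⁆⁆ = seg e (i + 1) (n + 1) := by
  have add_one_ne := add_one_ne_self hN
  have add_two_ne := add_one_add_one_ne_self hN
  by_cases h0 : (n : ZMod N) = 0
  · rcases eq_zero_or_exists_eq_add_three hN h0 with rfl | ⟨p, rfl⟩
    · simpa using he.lie_lie_next i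
    · have hp : (p : ZMod N) + 3 = 0 := by exact_mod_cast h0
      have shorten : ⁅e i, seg e (i + 1 + 1) (p + 2)⁆ = -seg e (i + 1 + 1) (p + 1) :=
        (H (p + 1) (by omega)).last (by push_cast; grind) (by push_cast; grind) _ _
          (by push_cast; grind)
      have lengthen : ⁅e i, seg e (i + 1 + 1) (p + 1)⁆ = -seg e (i + 1 + 1) (p + 2) :=
        (H p (by omega)).next (by grind) (by grind) _ _ (by grind)
      rw [seg_add_two_of_eq (n := p + 2) (by push_cast; grind), lie_add, lie_add,
        (lie_lie_winding_eq_self hN H he le_rfl hp i).1, shorten, lie_neg, lengthen, neg_neg]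
  · obtain ⟨k, rfl⟩ : ∃ k, n = k + 1 := Nat.exists_eq_succ_of_ne_zero (by rintro rfl; simp at h0)
    have hz : ⁅e i, seg e (i + 1 + 1) (k + 1)⁆ = 0 := by
      push_cast at *
      exact (H k (by omega)).apart h0 _ _ (by grind) (by grind) (by grind) (by grind)
    rw [seg_add_two_of_ne (by exact_mod_cast h0), leibniz_lie (e i) (e (i + 1)), hz, lie_zero,
      add_zero, leibniz_lie, hz, lie_zero, add_zero, he.lie_lie_next]

theorem lie_lie_seg_next (h1 : (n : ZMod N) + 1 ≠ 0) (h2 : (n : ZMod N) + 2 ≠ 0)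
    (i j : ZMod N) (hj : j = i + n + 1) :
    ⁅e j, ⁅e j, seg e i (n + 1)⁆⁆ = seg e i (n + 1) := by
  have add_one_ne := add_one_ne_self hN
  have add_two_ne := add_one_add_one_ne_self hN
  by_cases h0 : (n : ZMod N) = 0
  · obtain rfl : j = i + 1 := by rw [hj, h0, add_zero]
    rcases eq_zero_or_exists_eq_add_three hN h0 with rfl | ⟨p, rfl⟩
    · simpa using he.lie_lie_prev i
    · have hp : (p : ZMod N) + 3 = 0 := by exact_mod_cast h0
      have shorten : ⁅e (i + 1), seg e (i + 1) (p + 2)⁆ = seg e (i + 1 + 1) (p + 1) :=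
        (H (p + 1) (by omega)).first (by push_cast; grind) (by push_cast; grind) _
      have lengthen : ⁅e (i + 1), seg e (i + 1 + 1) (p + 1)⁆ = seg e (i + 1) (p + 2) :=
        (seg_add_two_of_ne (by grind) _).symm
      rw [seg_add_two_of_eq (n := p + 2) (by push_cast; grind), lie_add, lie_add,
        (lie_lie_winding_eq_self hN H he le_rfl hp i).2, shorten, lengthen]
  · obtain ⟨k, rfl⟩ : ∃ k, n = k + 1 := Nat.exists_eq_succ_of_ne_zero (by rintro rfl; simp at h0)
    push_cast at *
    have hz : ⁅e j, seg e i (k + 1)⁆ = 0 :=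
      (H k (by omega)).apart h0 _ _ (by grind) (by grind) (by grind) (by grind)
    obtain ⟨l, rfl⟩ : ∃ l, j = l + 1 := ⟨j - 1, by ring⟩
    have hs : seg e i (k + 2) = -⁅e l, seg e i (k + 1)⁆ := by
      rw [(H k (by omega)).next h0 (by grind) _ l (by grind), neg_neg]
    rw [hs, lie_neg, leibniz_lie (e (l + 1)) (e l), hz, lie_zero, add_zero, lie_neg,
      leibniz_lie, hz, lie_zero, add_zero, he.lie_lie_prev]

theorem lie_seg_first_last (h : (n : ZMod N) + 1 = 0) (i : ZMod N) :
    ⁅e i, seg e i (n + 2)⁆ = -seg e i (n + 1) := by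
  have add_one_ne := add_one_ne_self hN
  have add_two_ne := add_one_add_one_ne_self hN
  obtain ⟨l, rfl⟩ := exists_eq_add_two hN h
  push_cast at h
  obtain ⟨o, rfl⟩ : ∃ o, i = o + 1 := ⟨i - 1, by ring⟩
  have prepend_long : ⁅e (o + 1), seg e (o + 1 + 1) (l + 2)⁆ = seg e (o + 1) (l + 3) :=
    (seg_add_two_of_ne (n := l + 1) (by push_cast; grind) _).symm
  have prepend_short : ⁅e (o + 1), seg e (o + 1 + 1) (l + 1)⁆ = seg e (o + 1) (l + 2) :=
    (seg_add_two_of_ne (n := l) (by grind) _).symm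
  have shorten : ⁅e (o + 1), seg e (o + 1) (l + 2)⁆ = seg e (o + 1 + 1) (l + 1) :=
    (H (l + 1) (by omega)).first (by push_cast; grind) (by push_cast; grind) _
  have append : ⁅e o, seg e (o + 1 + 1) (l + 1)⁆ = -seg e (o + 1 + 1) (l + 2) :=
    (H l (by omega)).next (by grind) (by grind) _ _ (by grind)
  have quadruple := lie_lie_lie_lie_of_lie_lie_eq_self (he.lie_lie_prev o)
    (v := seg e (o + 1 + 1) (l + 1)) (by rw [prepend_short, shorten])
  have winding := (H (l + 2) le_rfl).winding_self (by push_cast; grind) (o + 1)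
  rw [append, lie_neg, prepend_long, lie_neg, lie_neg, winding, lie_neg, lie_nsmul] at quadruple
  rw [seg_add_two_of_eq (n := l + 2) (by push_cast; grind), lie_add, prepend_long]
  refine nsmul_right_injective two_ne_zero ?_
  linear_combination (norm := module) quadruple

theorem lie_seg_next (h2 : (n : ZMod N) + 2 ≠ 0) (h3 : (n : ZMod N) + 3 ≠ 0) (i j : ZMod N)
    (hj : j = i + n + 2) : ⁅e j, seg e i (n + 2)⁆ = -seg e i (n + 3) := by
  rw [seg_add_two_of_ne (n := n + 1) (by push_cast; grind)]
  by_cases h : (n : ZMod N) + 1 = 0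
  · obtain ⟨l, rfl⟩ := exists_eq_add_two hN h
    push_cast at h hj
    obtain rfl : j = i + 1 := by grind
    have shorten_first : ⁅e (i + 1), seg e (i + 1) (l + 2)⁆ = seg e (i + 1 + 1) (l + 1) :=
      (H (l + 1) (by omega)).first (by push_cast; grind) (by push_cast; grind) _
    have shorten_last : ⁅e i, seg e (i + 1 + 1) (l + 2)⁆ = -seg e (i + 1 + 1) (l + 1) :=
      (H (l + 1) (by omega)).last (by push_cast; grind) (by push_cast; grind) _ _
        (by push_cast; grind)
    have append : ⁅e i, seg e (i + 1 + 1) (l + 1)⁆ = -seg e (i + 1 + 1) (l + 2) :=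
      (H l (by omega)).next (by grind) (by grind) _ _ (by grind)
    have prepend_short : ⁅e (i + 1), seg e (i + 1 + 1) (l + 1)⁆ = seg e (i + 1) (l + 2) :=
      (seg_add_two_of_ne (n := l) (by grind) _).symm
    have prepend_long (o : ZMod N) : ⁅e o, seg e (o + 1) (l + 2)⁆ = seg e o (l + 3) :=
      (seg_add_two_of_ne (n := l + 1) (by push_cast; grind) o).symm
    have winding_self := (H (l + 2) le_rfl).winding_self (by push_cast; grind)
    have winding_next := (H (l + 2) le_rfl).winding_next (by push_cast; grind) i
    have winding_swap := lie_eq_neg_lie_of_winding (he.lie_lie_next i) (he.lie_lie_prev i)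
      (v := seg e (i + 1 + 1) (l + 1)) (by rw [append, lie_neg, shorten_last, neg_neg])
      (by rw [prepend_short, shorten_first]) (by rw [prepend_short, prepend_long])
      (by rw [append, lie_neg, prepend_long]) (winding_self i) winding_next (winding_self (i + 1))
    rw [seg_add_two_of_eq (n := l + 2) (by push_cast; grind),
      seg_add_two_of_eq (n := l + 2) (by push_cast; grind), lie_add, lie_add, shorten_first,
      shorten_last, winding_swap]
    abel
  · rw [seg_add_two_of_ne h, he.lie_lie_comm (by grind) (by grind),
      (H n le_rfl).next h h2 _ j (by grind), lie_neg]

theorem lie_seg_apart (h2 : (n : ZMod N) + 2 ≠ 0) (i j : ZMod N) (hj : j + 1 ≠ i) (hj' : j ≠ i)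
    (hj1 : j ≠ i + n + 1) (hj2 : j ≠ i + n + 2) : ⁅e j, seg e i (n + 2)⁆ = 0 := by
  have add_one_ne := add_one_ne_self hN
  by_cases h : (n : ZMod N) + 1 = 0
  · obtain ⟨l, rfl⟩ := exists_eq_add_two hN h
    have winding_zero : ⁅e j, ⁅e i, seg e (i + 1) (l + 3)⁆⁆ = 0 := by
      have hs := congrArg (⁅e j, ·⁆) ((H (l + 2) le_rfl).winding_self h i)
      rw [he.lie_lie_comm (by grind) (by grind),
        (H (l + 2) le_rfl).winding_apart h _ _ hj hj' (by grind), lie_zero, lie_neg, lie_nsmul,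
        zero_eq_neg] at hs
      simpa using hs
    push_cast at h hj1 hj2
    rw [seg_add_two_of_eq (n := l + 2) (by push_cast; grind), lie_add, winding_zero, zero_add]
    exact (H (l + 1) (by omega)).apart (by push_cast; grind) _ _ (by grind) (by grind)
      (by push_cast; grind) (by push_cast; grind)
  rw [seg_add_two_of_ne h]
  by_cases hji : j = i + 1
  · subst hji
    obtain ⟨k, rfl⟩ : ∃ k, n = k + 1 :=
      Nat.exists_eq_succ_of_ne_zero (by rintro rfl; push_cast at hj1; grind)
    have hd := (H (k + 1) le_rfl).first h (by grind) (i + 1)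
    push_cast at h h2 hj1 hj2
    have hs : seg e (i + 1) (k + 2) = ⁅e (i + 1), seg e (i + 1 + 1) (k + 1)⁆ :=
      seg_add_two_of_ne (by grind) _
    rw [hs]
    refine lie_lie_lie_eq_zero (he.lie_lie_prev i) ?_ (by rw [← hs, hd])
    exact (H k (by omega)).apart (by grind) _ _ (by grind) (by grind) (by grind) (by grind)
  · rw [he.lie_lie_comm (by grind) (by grind),
      (H n le_rfl).apart h _ _ (by grind) (by grind) (by grind) (by grind), lie_zero]

omit [IsAddTorsionFree L] in
theorem lie_seg_winding (h : (n : ZMod N) + 2 = 0) (i : ZMod N) :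
    ⁅e (i + 1), seg e (i + 1) (n + 2)⁆ = -(2 • ⁅e (i + 1), seg e i (n + 2)⁆) ∧
    ⁅e (i + 1), seg e (i + 1) (n + 2)⁆ = -(2 • ⁅e (i + 1), seg e (i + 1 + 1) (n + 2)⁆) := by
  have add_one_ne := add_one_ne_self hN
  have add_two_ne := add_one_add_one_ne_self hN
  obtain ⟨k, rfl⟩ : ∃ k, n = k + 1 := Nat.exists_eq_succ_of_ne_zero (by
    rintro rfl; exact add_two_ne 0 (by simpa [one_add_one_eq_two] using h))
  have prepend_long (j : ZMod N) : seg e j (k + 3) = ⁅e j, seg e (j + 1) (k + 2)⁆ :=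
    seg_add_two_of_ne (n := k + 1) (by grind) _
  have first := (H (k + 1) le_rfl).first (by grind) (by grind) (i + 1)
  have last := (H (k + 1) le_rfl).last (by grind) (by grind) (i + 1 + 1 + 1) (i + 1) (by grind)
  push_cast at h
  have prepend_short (j : ZMod N) : seg e j (k + 2) = ⁅e j, seg e (j + 1) (k + 1)⁆ :=
    seg_add_two_of_ne (by grind) _
  have next (j : ZMod N) : ⁅e j, seg e (j + 1 + 1) (k + 1)⁆ = -seg e (j + 1 + 1) (k + 2) :=
    (H k (by omega)).next (by grind) (by grind) _ _ (by grind)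
  constructor
  · have double := lie_lie_lie_of_lie_lie_eq_self (he.lie_lie_prev i)
      (v := seg e (i + 1 + 1) (k + 1)) (by rw [← prepend_short, first])
    rw [next, lie_neg, ← prepend_long, lie_neg, ← prepend_short, ← prepend_long] at double
    linear_combination (norm := module) -double
  · have double := lie_lie_lie_of_lie_lie_eq_self (he.lie_lie_next (i + 1))
      (v := seg e (i + 1 + 1 + 1) (k + 1)) (by rw [next, lie_neg, last, neg_neg])
    rw [next, lie_neg, ← prepend_long, lie_neg, ← prepend_short, ← prepend_long] at double
    linear_combination (norm := module) double

theorem segBrackets_succ : SegBrackets e (n + 1) where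
  first h1 h2 i := by
    push_cast at h1 h2
    rw [seg_add_two_of_ne h2, lie_lie_seg_prev hN H he h2 (by grind)]
  last h1 h2 i j hj := by
    push_cast at h1 h2 hj
    rw [← neg_neg (seg e i (n + 1 + 1)), ← (H n le_rfl).next h2 (by grind) i j (by grind), lie_neg,
      lie_lie_seg_next hN H he h2 (by grind) i j (by grind)]
  first_last h := lie_seg_first_last hN H he (by exact_mod_cast h)
  next h1 h2 i j hj := by
    push_cast at h1 h2 hj
    exact lie_seg_next hN H he (by grind) (by grind) i j (by grind)
  apart h1 i j hj hj' hj1 hj2 := by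
    push_cast at h1 hj1 hj2
    exact lie_seg_apart hN H he (by grind) i j hj hj' (by grind) (by grind)
  winding_self h i := by
    push_cast at h
    simpa using (lie_seg_winding hN H he (by grind) (i - 1)).2
  winding_next h i := by
    push_cast at h
    obtain ⟨h1, h2⟩ := lie_seg_winding hN H he (by grind) i
    exact nsmul_right_injective two_ne_zero (neg_injective (h1.symm.trans h2))
  winding_apart h i j hj hj' hj1 := by
    push_cast at h
    rw [seg_add_two_of_ne (by grind), he.lie_lie_comm (Ne.symm hj) hj1,
      (H n le_rfl).apart (by grind) _ _ (by grind) (by grind) (by grind) (by grind), lie_zero]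

end Step

theorem segBrackets [IsAddTorsionFree L] (hN : 3 ≤ N) (he : DolanGrady e) (n : ℕ) :
    SegBrackets e n := by
  induction n using Nat.strong_induction_on with
  | _ n ih =>
    rcases n with _ | n
    · exact segBrackets_zero hN he
    · exact segBrackets_succ hN (fun k hk => ih k (by omega)) he

end Segments

section Generation

variable {R L : Type*} [CommRing R] [LieRing L] [LieAlgebra R L] {s : Set L}

theorem eq_top_of_lie_mem (hs : LieSubalgebra.lieSpan R L s = ⊤) {W : Submodule R L}
    (hsW : s ⊆ W) (hW : ∀ x ∈ s, ∀ w ∈ W, ⁅x, w⁆ ∈ W) : W = ⊤ := by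
  have mem_lieSpan (x : L) : x ∈ LieSubalgebra.lieSpan R L s := hs ▸ LieSubalgebra.mem_top x
  have lie_mem (x : L) : ∀ w ∈ W, ⁅x, w⁆ ∈ W := by
    induction mem_lieSpan x using LieSubalgebra.lieSpan_induction with
    | mem x hx => exact hW x hx
    | zero => intro w _; simp
    | add x y _ _ hx hy => intro w hw; rw [add_lie]; exact add_mem (hx w hw) (hy w hw)
    | smul a x _ hx => intro w hw; rw [smul_lie]; exact W.smul_mem a (hx w hw)
    | lie x y _ _ hx hy =>
      intro w hw
      rw [lie_lie]
      exact sub_mem (hx _ (hy w hw)) (hy _ (hx w hw))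
  refine Submodule.eq_top_iff'.2 fun x => ?_
  induction mem_lieSpan x using LieSubalgebra.lieSpan_induction with
  | mem x hx => exact hsW hx
  | zero => exact W.zero_mem
  | add x y _ _ hx hy => exact add_mem hx hy
  | smul a x _ hx => exact W.smul_mem a hx
  | lie x y _ _ _ hy => exact lie_mem x y hy

theorem mem_center_of_lie_eq_zero (hs : LieSubalgebra.lieSpan R L s = ⊤) {z : L}
    (hz : ∀ x ∈ s, ⁅x, z⁆ = 0) : z ∈ LieAlgebra.center R L := by
  refine (LieModule.mem_maxTrivSubmodule R L L z).2 fun x => ?_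
  induction (hs ▸ LieSubalgebra.mem_top x : x ∈ LieSubalgebra.lieSpan R L s)
    using LieSubalgebra.lieSpan_induction with
  | mem x hx => exact hz x hx
  | zero => exact zero_lie z
  | add x y _ _ hx hy => rw [add_lie, hx, hy, add_zero]
  | smul a x _ hx => rw [smul_lie, hx, smul_zero]
  | lie x y _ _ hx hy => rw [lie_lie, hx, hy, lie_zero, lie_zero, sub_zero]

end Generation

section SegmentsSpan

variable {N : ℕ} {L : Type*} [LieRing L] [IsAddTorsionFree L] {e : ZMod N → L}

theorem lie_seg_mem_span (R : Type*) [CommRing R] [LieAlgebra R L] (hN : 3 ≤ N)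
    (he : DolanGrady e) (i j : ZMod N) (n : ℕ) :
    ⁅e j, seg e i n⁆ ∈ Submodule.span R (Set.range fun p : ZMod N × ℕ => seg e p.1 p.2) := by
  set S := Submodule.span R (Set.range fun p : ZMod N × ℕ => seg e p.1 p.2)
  have seg_mem (i : ZMod N) (n : ℕ) : seg e i n ∈ S := Submodule.subset_span ⟨(i, n), rfl⟩
  rcases n with _ | n
  · simp
  have H := segBrackets hN he n
  have winding_mem (h : (n : ZMod N) + 1 = 0) : ⁅e j, seg e (j + 1) (n + 1)⁆ ∈ S := by
    rw [← add_sub_cancel_right ⁅e j, seg e (j + 1) (n + 1)⁆, ← seg_add_two_of_eq h]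
    exact sub_mem (seg_mem _ _) (seg_mem _ _)
  by_cases hprev : j + 1 = i
  · subst hprev
    by_cases h : (n : ZMod N) + 1 = 0
    · exact winding_mem h
    · rw [← seg_add_two_of_ne h]
      exact seg_mem _ _
  by_cases h : (n : ZMod N) + 1 = 0
  · by_cases hself : j = i
    · subst hself
      exact H.winding_self h j ▸ neg_mem (nsmul_mem (winding_mem h) 2)
    by_cases hnext : j = i + 1
    · subst hnext
      exact H.winding_next h i ▸ winding_mem h
    · exact H.winding_apart h i j hprev hself hnext ▸ zero_mem S
  by_cases hnext : j = i + n + 1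
  · exact H.next h (by grind) i j hnext ▸ neg_mem (seg_mem _ _)
  by_cases h0 : (n : ZMod N) = 0
  · by_cases hself : j = i
    · subst hself
      exact H.first_last h0 j ▸ neg_mem (seg_mem _ _)
    · exact H.apart h i j hprev hself (by simpa [h0] using hself) hnext ▸ zero_mem S
  by_cases hfirst : j = i
  · subst hfirst
    exact H.first h h0 j ▸ seg_mem _ _
  by_cases hlast : j = i + n
  · exact H.last h h0 i j hlast ▸ neg_mem (seg_mem _ _)
  · exact H.apart h i j hprev hfirst hlast hnext ▸ zero_mem S

theorem span_range_seg {R : Type*} [CommRing R] [LieAlgebra R L] (hN : 3 ≤ N) (he : DolanGrady e)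
    (hgen : LieSubalgebra.lieSpan R L (Set.range e) = ⊤) :
    Submodule.span R (Set.range fun p : ZMod N × ℕ => seg e p.1 p.2) = ⊤ := by
  refine eq_top_of_lie_mem hgen ?_ ?_
  · rintro _ ⟨i, rfl⟩
    exact Submodule.subset_span ⟨(i, 1), seg_one i⟩
  · rintro _ ⟨j, rfl⟩ w hw
    induction hw using Submodule.span_induction with
    | mem w hw =>
      obtain ⟨⟨i, n⟩, rfl⟩ := hw
      exact lie_seg_mem_span R hN he i j n
    | zero => simp
    | add v w _ _ hv hw => rw [lie_add]; exact add_mem hv hw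
    | smul a w _ hw => rw [lie_smul]; exact Submodule.smul_mem _ a hw

theorem lie_sum_seg [NeZero N] (hN : 3 ≤ N) (he : DolanGrady e) {n : ℕ} (hn : (n : ZMod N) = 0)
    (j : ZMod N) : ⁅e j, ∑ b, seg e b n⁆ = 0 := by
  have add_one_ne := add_one_ne_self hN
  have add_two_ne := add_one_add_one_ne_self hN
  rcases n with _ | n
  · simp
  have h : (n : ZMod N) + 1 = 0 := by exact_mod_cast hn
  have H := segBrackets hN he n
  set w := ⁅e j, seg e (j + 1) (n + 1)⁆ with hw
  have lie_seg (b : ZMod N) : ⁅e j, seg e b (n + 1)⁆ =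
      (if b = j + 1 then w else 0) - 2 • (if b = j then w else 0) + if b = j - 1 then w else 0 := by
    by_cases hb1 : b = j + 1
    · subst hb1
      rw [if_pos rfl, if_neg (by grind), if_neg (by grind), smul_zero, sub_zero, add_zero]
    by_cases hb2 : b = j
    · subst hb2
      rw [if_neg hb1, if_pos rfl, if_neg (by grind), H.winding_self h, zero_sub, add_zero]
    by_cases hb3 : b = j - 1
    · obtain rfl : j = b + 1 := by rw [hb3, sub_add_cancel]
      rw [if_neg hb1, if_neg hb2, if_pos hb3, H.winding_next h, smul_zero, sub_zero, zero_add]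
    rw [if_neg hb1, if_neg hb2, if_neg hb3, H.winding_apart h _ _ (Ne.symm hb1) (Ne.symm hb2)
      (by grind), smul_zero, sub_zero, add_zero]
  simp only [lie_sum, lie_seg, Finset.sum_add_distrib, Finset.sum_sub_distrib, ← Finset.smul_sum,
    Finset.sum_ite_eq', Finset.mem_univ, if_true]
  abel

theorem sum_seg_mem_center [NeZero N] {R : Type*} [CommRing R] [LieAlgebra R L] (hN : 3 ≤ N)
    (he : DolanGrady e) (hgen : LieSubalgebra.lieSpan R L (Set.range e) = ⊤) {n : ℕ}
    (hn : (n : ZMod N) = 0) : ∑ b, seg e b n ∈ LieAlgebra.center R L :=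
  mem_center_of_lie_eq_zero hgen (Set.forall_mem_range.2 (lie_sum_seg hN he hn))

end SegmentsSpan

section LoopRealization

/-- The square matrices over the complex Laurent polynomials in which the loop realization lives,
with rows and columns labelled by `ZMod N`. -/
abbrev LoopMatrix (N : ℕ) : Type := Matrix (ZMod N) (ZMod N) ℂ[T;T⁻¹]

variable {N : ℕ}

/-- The matrix unit `E_{a,b}` with the weight `T ^ r`. -/
noncomputable def matUnit (a b : ZMod N) (r : ℤ) : LoopMatrix N := Matrix.single a b (T r)

/-- The matrix `X_{a,b} = E_{a,b} - (-1) ^ r E_{b,a}` with the weights `T ^ r` and `T ^ (-r)`. It is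
meant for `b = a + r`, but leaving the residue `b` free of `r` makes the brackets uniform. -/
noncomputable def loopX (a b : ZMod N) (r : ℤ) : LoopMatrix N :=
  matUnit a b r - (-1 : ℂ) ^ r • matUnit b a (-r)

/-- The images of the letters in the loop realization, in the principal gauge: every arrow of the
cycle carries one factor `T`. -/
noncomputable def loopGen (j : ZMod N) : LoopMatrix N :=
  matUnit j (j + 1) 1 + matUnit (j + 1) j (-1)

theorem loopX_self_zero (a : ZMod N) : loopX a a 0 = 0 := by simp [loopX]

theorem loopGen_eq_loopX (j : ZMod N) : loopGen j = loopX j (j + 1) 1 := by simp [loopGen, loopX]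

variable [NeZero N]

theorem matUnit_mul (a b c d : ZMod N) (r q : ℤ) :
    matUnit a b r * matUnit c d q = if b = c then matUnit a d (r + q) else 0 := by
  split_ifs with h
  · rw [matUnit, matUnit, matUnit, h, Matrix.single_mul_single_same, LaurentPolynomial.T_add]
  · exact Matrix.single_mul_single_of_ne _ _ _ _ h _

theorem lie_loopGen_matUnit (j a b : ZMod N) (r : ℤ) : ⁅loopGen j, matUnit a b r⁆ =
    (if j + 1 = a then matUnit j b (r + 1) else 0) +
      (if j = a then matUnit (j + 1) b (r - 1) else 0) -
      (if b = j then matUnit a (j + 1) (r + 1) else 0) -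
      (if b = j + 1 then matUnit a j (r - 1) else 0) := by
  rw [LieRing.of_associative_ring_bracket, loopGen, add_mul, mul_add]
  simp only [matUnit_mul, add_comm (1 : ℤ), add_comm (-1 : ℤ), ← sub_eq_add_neg]
  abel

theorem lie_loopGen_loopX (j a b : ZMod N) (r : ℤ) : ⁅loopGen j, loopX a b r⁆ =
    (if j + 1 = a then loopX j b (r + 1) else 0) +
      (if j = a then loopX (j + 1) b (r - 1) else 0) -
      (if b = j then loopX a (j + 1) (r + 1) else 0) -
      (if b = j + 1 then loopX a j (r - 1) else 0) := by
  have neg_succ : -(r + 1) = -r - 1 := by ring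
  have neg_pred : -(r - 1) = -r + 1 := by ring
  have neg_one_ne : (-1 : ℂ) ≠ 0 := by norm_num
  simp only [loopX, lie_sub, lie_smul, lie_loopGen_matUnit, eq_comm (a := a), eq_comm (a := b),
    neg_succ, neg_pred, zpow_add_one₀ neg_one_ne, zpow_sub_one₀ neg_one_ne, inv_neg_one]
  split_ifs <;> module

theorem lie_loopX_loopX {a b c : ZMod N} (hab : a ≠ b) (hbc : b ≠ c) (hac : a ≠ c) (r q : ℤ) :
    ⁅loopX a b r, loopX b c q⁆ = loopX a c (r + q) := by
  simp only [LieRing.of_associative_ring_bracket, loopX, sub_mul, mul_sub, Algebra.smul_mul_assoc,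
    Algebra.mul_smul_comm, matUnit_mul, hab, hbc, hac, hab.symm, hbc.symm, hac.symm, if_true,
    if_false, neg_add_rev, zpow_add₀ (by norm_num : (-1 : ℂ) ≠ 0)]
  module

theorem dolanGrady_loopGen (hN : 3 ≤ N) : DolanGrady (loopGen (N := N)) where
  adjacent i j h := by
    have add_one_ne := add_one_ne_self hN
    have add_two_ne := add_one_add_one_ne_self hN
    have one_ne : (1 : ZMod N) ≠ 0 := by simpa using add_one_ne 0
    rcases h with rfl | rfl
    · simp [loopGen_eq_loopX (i + 1), lie_loopGen_loopX, add_two_ne, one_ne]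
    · simp [loopGen_eq_loopX j, lie_loopGen_loopX, add_two_ne, one_ne]
  not_adjacent i j h := by
    obtain ⟨ne_next, ne_prev⟩ := not_or.mp h
    rw [loopGen_eq_loopX j, lie_loopGen_loopX, if_neg (Ne.symm ne_next), if_neg (Ne.symm ne_prev)]
    by_cases hij : i = j
    · simp [hij, loopX_self_zero]
    · simp [hij, Ne.symm hij]

theorem seg_loopGen (hN : 3 ≤ N) (r : ℕ) (i : ZMod N) : seg loopGen i r =
    loopX i (i + (r : ZMod N)) (r : ℤ) -
      if (r : ZMod N) = 0 then loopX (i + 1) (i + 1 + (r : ZMod N)) (r : ℤ) else 0 := by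
  have add_one_ne := add_one_ne_self hN
  have add_two_ne := add_one_add_one_ne_self hN
  induction r using Nat.strong_induction_on generalizing i with
  | _ r ih =>
    rcases r with _ | _ | n
    · simp [loopX_self_zero]
    · have one_ne : (1 : ZMod N) ≠ 0 := by simpa using add_one_ne 0
      simp [loopGen_eq_loopX, one_ne]
    · push_cast
      by_cases h : (n : ZMod N) + 1 = 0
      · rw [seg_add_two_of_eq h, ih (n + 1) (by omega), ih n (by omega)]
        push_cast
        rw [if_pos h, if_neg (by grind), if_neg (by grind), lie_sub, lie_loopGen_loopX,
          lie_loopGen_loopX, if_pos rfl, if_neg (by grind), if_neg (by grind), if_pos (by grind),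
          if_neg (by grind), if_neg (by grind), if_neg (by grind), if_neg (by grind),
          add_sub_cancel_right (n : ℤ), show i + 1 + (n : ZMod N) = i by grind,
          show i + 1 + ((n : ZMod N) + 1) = i + ((n : ZMod N) + 1 + 1) by ring]
        abel
      · rw [seg_add_two_of_ne h, ih (n + 1) (by omega)]
        push_cast
        rw [if_neg h, sub_zero, lie_loopGen_loopX, if_pos rfl, if_neg (by grind),
          if_neg (by grind : ¬ i + 1 + ((n : ZMod N) + 1) = i + 1), add_zero, sub_zero,
          show i + 1 + ((n : ZMod N) + 1) = i + ((n : ZMod N) + 1 + 1) by ring]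
        have wrap_iff : i + ((n : ZMod N) + 1 + 1) = i ↔ (n : ZMod N) + 1 + 1 = 0 := add_eq_left
        simp only [wrap_iff]
        split_ifs with h2
        · rw [h2, add_zero, add_zero]
        · rfl

end LoopRealization

section LoopKernel

theorem apply_eq_apply_zero_of_add_one {N : ℕ} [NeZero N] {α : Type*} {g : ZMod N → α}
    (hg : ∀ a, g (a + 1) = g a) (a : ZMod N) : g a = g 0 := by
  obtain ⟨n, rfl⟩ := ZMod.natCast_zmod_surjective a
  induction n with
  | zero => rw [Nat.cast_zero]
  | succ n ih => rw [Nat.cast_succ, hg, ih]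

variable {N : ℕ}

/-- The coefficient of `T ^ r` in the entry of a loop matrix at the place `(a, a + r)`. -/
noncomputable def loopCoeff (a : ZMod N) (r : ℕ) : LoopMatrix N →ₗ[ℂ] ℂ where
  toFun M := (M a (a + r)).coeff r
  map_add' _ _ := rfl
  map_smul' _ _ := rfl

theorem loopCoeff_matUnit (a i j : ZMod N) (r : ℕ) (q : ℤ) : loopCoeff a r (matUnit i j q) =
    if (i = a ∧ j = a + r) ∧ q = r then 1 else 0 := by
  change ((Matrix.single i j (T q) : LoopMatrix N) a (a + r)).coeff (r : ℤ) = _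
  rw [Matrix.single_apply, ite_and]
  split_ifs with place length <;> simp_all [LaurentPolynomial.T_apply]

theorem loopCoeff_loopX {r : ℕ} (hr : r ≠ 0) (a i : ZMod N) (q : ℕ) :
    loopCoeff a r (loopX i (i + (q : ZMod N)) (q : ℤ)) = if (i, q) = (a, r) then 1 else 0 := by
  have neg_ne : -(q : ℤ) ≠ r := by omega
  rw [loopX, map_sub, map_smul, loopCoeff_matUnit, loopCoeff_matUnit,
    if_neg (fun h : _ ∧ -(q : ℤ) = r => neg_ne h.2), smul_zero, sub_zero]
  refine if_congr ⟨fun h => ?_, fun h => ?_⟩ rfl rfl <;> simp_all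

theorem map_seg {R L L' : Type*} [CommRing R] [LieRing L] [LieAlgebra R L] [LieRing L']
    [LieAlgebra R L'] {e : ZMod N → L} {e' : ZMod N → L'} (f : L →ₗ⁅R⁆ L')
    (hf : ∀ i, f (e i) = e' i) (i : ZMod N) (r : ℕ) : f (seg e i r) = seg e' i r := by
  induction r using Nat.strong_induction_on generalizing i with
  | _ r ih =>
    rcases r with _ | _ | n
    · simp
    · simp [hf]
    · by_cases h : (n : ZMod N) + 1 = 0
      · rw [seg_add_two_of_eq h, seg_add_two_of_eq h, map_add, LieHom.map_lie, hf,
          ih (n + 1) (by omega), ih n (by omega)]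
      · rw [seg_add_two_of_ne h, seg_add_two_of_ne h, LieHom.map_lie, hf, ih (n + 1) (by omega)]

variable [NeZero N] {L : Type*} [LieRing L] [LieAlgebra ℂ L] {e : ZMod N → L}

theorem loopCoeff_seg_loopGen (hN : 3 ≤ N) {r : ℕ} (hr : r ≠ 0) (a i : ZMod N) (q : ℕ) :
    loopCoeff a r (seg loopGen i q) = (if (i, q) = (a, r) then 1 else 0) -
      if (r : ZMod N) = 0 then if (i, q) = (a - 1, r) then 1 else 0 else 0 := by
  rw [seg_loopGen hN, map_sub, loopCoeff_loopX hr, apply_ite (loopCoeff a r), map_zero,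
    loopCoeff_loopX hr]
  by_cases h : q = r <;> simp [h, eq_sub_iff_add_eq]

theorem loopCoeff_map_linearCombination (hN : 3 ≤ N) (f : L →ₗ⁅ℂ⁆ LoopMatrix N)
    (hf : ∀ i, f (e i) = loopGen i) (c : ZMod N × ℕ →₀ ℂ) {r : ℕ} (hr : r ≠ 0) (a : ZMod N) :
    loopCoeff a r (f (Finsupp.linearCombination ℂ (fun p => seg e p.1 p.2) c)) =
      c (a, r) - if (r : ZMod N) = 0 then c (a - 1, r) else 0 := by
  classical
  induction c using Finsupp.induction_linear with
  | zero => simp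
  | add c d hc hd =>
    rw [map_add, map_add, map_add, hc, hd]
    split_ifs <;> simp only [Finsupp.add_apply] <;> ring
  | single p z =>
    rw [Finsupp.linearCombination_single, map_smul, map_smul, map_seg f hf,
      loopCoeff_seg_loopGen hN hr, Finsupp.single_apply, Finsupp.single_apply]
    split_ifs <;> simp

theorem mem_of_map_eq_zero (hN : 3 ≤ N)
    (hspan : Submodule.span ℂ (Set.range fun p : ZMod N × ℕ => seg e p.1 p.2) = ⊤)
    (f : L →ₗ⁅ℂ⁆ LoopMatrix N) (hf : ∀ i, f (e i) = loopGen i) {C : Submodule ℂ L}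
    (hC : ∀ n : ℕ, (n : ZMod N) = 0 → ∑ b, seg e b n ∈ C) {x : L} (hx : f x = 0) : x ∈ C := by
  classical
  obtain ⟨c, rfl⟩ :=
    Finsupp.mem_span_range_iff_exists_finsupp.mp (hspan.symm ▸ Submodule.mem_top (x := x))
  have coeff_eq (r : ℕ) (hr : r ≠ 0) (a : ZMod N) :
      c (a, r) = if (r : ZMod N) = 0 then c (a - 1, r) else 0 := by
    rw [← sub_eq_zero, ← loopCoeff_map_linearCombination hN f hf c hr a,
      Finsupp.linearCombination_apply, hx, map_zero]
  have sum_length_mem (r : ℕ) : ∑ a, c (a, r) • seg e a r ∈ C := by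
    rcases eq_or_ne r 0 with rfl | hr
    · simp
    by_cases h : (r : ZMod N) = 0
    · have coeff_const := apply_eq_apply_zero_of_add_one (g := fun a => c (a, r))
        fun a => by simpa [h] using coeff_eq r hr (a + 1)
      simp only [coeff_const, ← Finset.smul_sum]
      exact C.smul_mem _ (hC r h)
    · simp [coeff_eq r hr, h]
  have support_subset : c.support ⊆ Finset.univ ×ˢ c.support.image Prod.snd := fun p hp =>
    Finset.mem_product.mpr ⟨Finset.mem_univ _, Finset.mem_image_of_mem _ hp⟩
  rw [c.sum_of_support_subset support_subset _ (by simp), Finset.sum_product_right]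
  exact C.sum_mem fun r _ => sum_length_mem r

end LoopKernel

section Injectivity

/-- The sum, over all turns of the cycle, of the brackets of two consecutive segments of lengths `s`
and `q`. It is used when `N ∣ s + q`, so that the two segments together close up. -/
def cyclicBracket {N : ℕ} [NeZero N] {L : Type*} [LieRing L] (e : ZMod N → L) (s q : ℕ) : L :=
  ∑ i, ⁅seg e i s, seg e (i + s) q⁆

theorem exists_lt_add_eq_of_natCast_ne_zero {N s : ℕ} (hN : 3 ≤ N) (hs : (s : ZMod N) ≠ 0)
    (h1 : s ≠ 1) : ∃ a b, a < s ∧ b < s ∧ a + b = s ∧ (a : ZMod N) ≠ 0 ∧ (b : ZMod N) ≠ 0 := by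
  have add_one_ne := add_one_ne_self hN
  have add_two_ne := add_one_add_one_ne_self hN
  rcases s with _ | _ | s
  · simp at hs
  · simp at h1
  · by_cases h : (s : ZMod N) + 1 = 0
    · rcases s with _ | s
      · grind
      · exact ⟨s + 1, 2, by omega, by omega, by omega, by grind, by grind⟩
    · exact ⟨s + 1, 1, by omega, by omega, by omega, by grind, by grind⟩

variable {N : ℕ} [NeZero N] {L : Type*} [LieRing L] {e : ZMod N → L}

theorem cyclicBracket_swap {s q : ℕ} (h : (s : ZMod N) + q = 0) :
    cyclicBracket e s q = -cyclicBracket e q s := by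
  rw [cyclicBracket, cyclicBracket, ← Finset.sum_neg_distrib,
    ← Equiv.sum_comp (Equiv.addRight (s : ZMod N)) fun i => -⁅seg e i q, seg e (i + q) s⁆]
  refine Finset.sum_congr rfl fun i _ => ?_
  rw [lie_skew, Equiv.coe_addRight, add_assoc i, h, add_zero]

theorem cyclicBracket_one (hN : 3 ≤ N) {q : ℕ} (h : (1 : ZMod N) + q = 0) :
    cyclicBracket e 1 q = ∑ b, seg e b (1 + q) := by
  have add_one_ne := add_one_ne_self hN
  refine Finset.sum_congr rfl fun i _ => ?_
  rcases q with _ | n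
  · grind
  · rw [seg_one, Nat.cast_one, show 1 + (n + 1) = n + 2 by ring, seg_add_two_of_ne (by grind)]

variable [LieAlgebra ℂ L] (hN : 3 ≤ N) (he : DolanGrady e)
  (hgen : LieSubalgebra.lieSpan ℂ L (Set.range e) = ⊤) (f : L →ₗ⁅ℂ⁆ LoopMatrix N)
  (hf : ∀ i, f (e i) = loopGen i)
include hN he hgen hf

theorem lie_lie_seg {r q : ℕ} (hr : (r : ZMod N) ≠ 0) (hq : (q : ZMod N) ≠ 0)
    (hrq : (r : ZMod N) + q ≠ 0) {a b : ZMod N} (hb : b = a + r) (y : L) :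
    ⁅y, ⁅seg e a r, seg e b q⁆⁆ = ⁅y, seg e a (r + q)⁆ := by
  have := IsAddTorsionFree.of_isTorsionFree ℂ L
  have map_eq_zero : f (⁅seg e a r, seg e b q⁆ - seg e a (r + q)) = 0 := by
    rw [map_sub, LieHom.map_lie, map_seg f hf, map_seg f hf, map_seg f hf, seg_loopGen hN,
      seg_loopGen hN, seg_loopGen hN, if_neg hr, if_neg hq, if_neg (by exact_mod_cast hrq), hb,
      sub_zero, sub_zero, sub_zero, lie_loopX_loopX (by grind) (by grind) (by grind)]
    push_cast
    rw [add_assoc, sub_self]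
  have mem_center : ⁅seg e a r, seg e b q⁆ - seg e a (r + q) ∈
      (LieAlgebra.center ℂ L).toSubmodule :=
    mem_of_map_eq_zero hN (span_range_seg hN he hgen) f hf
      (fun _ hn => sum_seg_mem_center hN he hgen hn) map_eq_zero
  rw [← sub_eq_zero, ← lie_sub]
  exact (LieModule.mem_maxTrivSubmodule ℂ L L _).mp mem_center y

theorem lie_seg_add {s t q : ℕ} (hs : (s : ZMod N) ≠ 0) (ht : (t : ZMod N) ≠ 0)
    (hst : (s : ZMod N) + t ≠ 0) (hq : (s : ZMod N) + t + q = 0) (i : ZMod N) :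
    ⁅seg e i (s + t), seg e (i + s + t) q⁆ =
      ⁅seg e i s, seg e (i + s) (t + q)⁆ + ⁅seg e (i + s) t, seg e (i + s + t) (q + s)⁆ := by
  have split_first : ⁅seg e i (s + t), seg e (i + s + t) q⁆ =
      ⁅⁅seg e i s, seg e (i + s) t⁆, seg e (i + s + t) q⁆ := by
    rw [← lie_skew, ← lie_skew _ (seg e (i + s + t) q), lie_lie_seg hN he hgen f hf hs ht hst rfl]
  have join_last := lie_lie_seg hN he hgen f hf (r := t) (q := q) ht (by grind) (by grind)
    (a := i + s) rfl (seg e i s)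
  have join_around := lie_lie_seg hN he hgen f hf (r := q) (q := s) (by grind) hs (by grind)
    (a := i + s + t) (b := i) (by grind) (seg e (i + s) t)
  rw [split_first, lie_lie, join_last, ← lie_skew (seg e i s) (seg e (i + s + t) q), lie_neg,
    join_around]
  abel

theorem cyclicBracket_add {s t q : ℕ} (hs : (s : ZMod N) ≠ 0) (ht : (t : ZMod N) ≠ 0)
    (hst : (s : ZMod N) + t ≠ 0) (hq : (s : ZMod N) + t + q = 0) :
    cyclicBracket e (s + t) q = cyclicBracket e s (t + q) + cyclicBracket e t (q + s) := by
  rw [cyclicBracket, cyclicBracket, cyclicBracket, ← Equiv.sum_comp (Equiv.addRight (s : ZMod N))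
    fun i => ⁅seg e i t, seg e (i + t) (q + s)⁆, ← Finset.sum_add_distrib]
  refine Finset.sum_congr rfl fun i _ => ?_
  rw [Nat.cast_add, ← add_assoc, Equiv.coe_addRight]
  exact lie_seg_add hN he hgen f hf hs ht hst hq i

theorem cyclicBracket_eq_nsmul {s q : ℕ} (hs : (s : ZMod N) ≠ 0) (hq : (s : ZMod N) + q = 0) :
    cyclicBracket e s q = s • ∑ b, seg e b (s + q) := by
  induction s using Nat.strong_induction_on generalizing q with
  | _ s ih =>
    by_cases h1 : s = 1
    · rw [h1, one_nsmul, cyclicBracket_one hN (by simpa [h1] using hq)]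
    obtain ⟨a, b, ha, hb, rfl, ha0, hb0⟩ := exists_lt_add_eq_of_natCast_ne_zero hN hs h1
    push_cast at hs hq
    rw [cyclicBracket_add hN he hgen f hf ha0 hb0 hs hq, ih a ha ha0 (by push_cast; grind),
      ih b hb hb0 (by push_cast; grind), add_nsmul, show b + (q + a) = a + b + q by ring,
      add_assoc]

theorem sum_seg_eq_zero {n : ℕ} (hn : (n : ZMod N) = 0) : ∑ b, seg e b n = 0 := by
  have := IsAddTorsionFree.of_isTorsionFree ℂ L
  have add_one_ne := add_one_ne_self hN
  rcases n with _ | q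
  · simp
  have nsmul_eq : q • ∑ b, seg e b (q + 1) = -∑ b, seg e b (q + 1) := by
    rw [← cyclicBracket_eq_nsmul hN he hgen f hf (by grind) (by exact_mod_cast hn),
      cyclicBracket_swap (by exact_mod_cast hn), cyclicBracket_one hN (by grind), add_comm]
  refine nsmul_right_injective q.succ_ne_zero ?_
  simp only [Nat.succ_eq_add_one, succ_nsmul, nsmul_eq, nsmul_zero, neg_add_cancel, add_zero]

theorem injective_of_map_eq_loopGen : Function.Injective f := by
  have := IsAddTorsionFree.of_isTorsionFree ℂ L
  refine (injective_iff_map_eq_zero f).mpr fun x hx => (Submodule.mem_bot ℂ).mp ?_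
  exact mem_of_map_eq_zero hN (span_range_seg hN he hgen) f hf
    (fun _ hn => (Submodule.mem_bot ℂ).mpr (sum_seg_eq_zero hN he hgen f hf hn)) hx

end Injectivity

section LoopIntegrals

variable {N : ℕ}

theorem T_smul_matUnit (a b : ZMod N) (q r : ℤ) :
    (T q : ℂ[T;T⁻¹]) • matUnit a b r = matUnit a b (q + r) := by
  rw [matUnit, matUnit, Matrix.smul_single, smul_eq_mul, LaurentPolynomial.T_add]

/-- The scalar `u = t + (-1) ^ N t⁻¹` with `t = T ^ N`, in which the integrals are polynomials. -/
noncomputable def loopU (N : ℕ) : ℂ[T;T⁻¹] := T N + (-1) ^ N * T (-N)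

/-- The scalar `v = t - (-1) ^ N t⁻¹` with `t = T ^ N`; its square is `u ^ 2 - 4 (-1) ^ N`. -/
noncomputable def loopV (N : ℕ) : ℂ[T;T⁻¹] := T N - (-1) ^ N * T (-N)

/-- The coefficient of the matrix unit `E_{i,i+1}` in the string of length `N m + 1`. -/
noncomputable def upperCoeff (N : ℕ) : ℕ → ℂ[T;T⁻¹]
  | 0 => 1
  | m + 1 => loopU N ^ m * loopV N

/-- The coefficient of the matrix unit `E_{i+1,i}` in the string of length `N m + 1`. -/
noncomputable def lowerCoeff (N : ℕ) : ℕ → ℂ[T;T⁻¹]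
  | 0 => 1
  | m + 1 => -(loopU N ^ m * loopV N)

theorem lowerCoeff_succ (m : ℕ) : lowerCoeff N (m + 1) = -upperCoeff N (m + 1) := rfl

theorem upperCoeff_succ (m : ℕ) : upperCoeff N (m + 1) =
    upperCoeff N m * T N - (-1) ^ N * lowerCoeff N m * T (-N) := by
  rcases m with _ | m
  · simp [upperCoeff, lowerCoeff, loopV]
  · rw [upperCoeff, upperCoeff, lowerCoeff, pow_succ, loopU]; ring

variable [NeZero N]

theorem strand_loopGen_add {n : ℕ} {x y : ℂ[T;T⁻¹]}
    (h : ∀ i : ZMod N, strand loopGen i (n + 1) = x • matUnit i (i + 1) 1 +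
      y • matUnit (i + 1) i (-1)) {s : ℕ} (hs : s + 2 ≤ N) (i : ZMod N) :
    strand loopGen i (n + s + 1) = x • matUnit i (i + (s : ZMod N) + 1) (s + 1) +
      ((-1) ^ s * y) • matUnit (i + (s : ZMod N) + 1) i (-(s + 1)) := by
  induction s generalizing i with
  | zero => simpa using h i
  | succ s ih =>
    have succ_ne : (s : ZMod N) + 1 ≠ 0 := by
      exact_mod_cast natCast_ne_zero_of_lt (N := N) (s := s + 1) (by omega) (by omega)
    have succ_succ_ne : (s : ZMod N) + 2 ≠ 0 := by
      exact_mod_cast natCast_ne_zero_of_lt (N := N) (s := s + 2) (by omega) (by omega)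
    have add_one_ne := add_one_ne_self (N := N) (by omega)
    obtain ⟨b, hb⟩ : ∃ b, b = i + ((s : ZMod N) + 1) + 1 := ⟨_, rfl⟩
    have start_next : i + 1 + (s : ZMod N) + 1 = b := by rw [hb]; ring
    push_cast
    rw [← add_assoc n, strand, ih (by omega), start_next, ← hb, lie_add, lie_smul, lie_smul,
      lie_loopGen_matUnit, lie_loopGen_matUnit, if_pos rfl, if_neg (by grind), if_neg (by grind),
      if_neg (by grind), if_neg (by grind), if_neg (by grind), if_neg (by grind), if_pos rfl,
      pow_succ, neg_add' ((s : ℤ) + 1)]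
    module

theorem strand_loopGen_add_period (hN : 3 ≤ N) {n : ℕ} {x y : ℂ[T;T⁻¹]}
    (h : ∀ i : ZMod N, strand loopGen i (n + 1) = x • matUnit i (i + 1) 1 +
      y • matUnit (i + 1) i (-1)) (i : ZMod N) :
    strand loopGen i (n + N) =
      (x * T N - (-1) ^ N * y * T (-N)) • (matUnit i i 0 - matUnit (i + 1) (i + 1) 0) := by
  have add_one_ne := add_one_ne_self hN
  obtain ⟨s, rfl⟩ : ∃ s, N = s + 2 := ⟨N - 2, by omega⟩
  have period : (s : ZMod (s + 2)) + 2 = 0 := by exact_mod_cast ZMod.natCast_self (s + 2)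
  rw [← add_assoc, strand, strand_loopGen_add h le_rfl, lie_add, lie_smul, lie_smul,
    lie_loopGen_matUnit, lie_loopGen_matUnit, if_pos rfl, if_neg (by grind), if_pos (by grind),
    if_neg (by grind), if_neg (by grind), if_pos (by grind), if_neg (by grind), if_pos rfl,
    sub_smul, mul_smul x, mul_smul (_ * y), smul_sub (T _), smul_sub (T _)]
  simp only [T_smul_matUnit]
  push_cast
  rw [show i + 1 + (s : ZMod (s + 2)) + 1 = i by grind,
    show (s : ℤ) + 1 + 1 = s + 2 + 0 by ring, show -((s : ℤ) + 1) - 1 = -(s + 2) + 0 by ring,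
    pow_add]
  module

theorem strand_loopGen_add_period_add_one (hN : 3 ≤ N) {n : ℕ} {x y : ℂ[T;T⁻¹]}
    (h : ∀ i : ZMod N, strand loopGen i (n + 1) = x • matUnit i (i + 1) 1 +
      y • matUnit (i + 1) i (-1)) (i : ZMod N) :
    strand loopGen i (n + N + 1) =
      (x * T N - (-1) ^ N * y * T (-N)) • (matUnit i (i + 1) 1 - matUnit (i + 1) i (-1)) := by
  have add_one_ne := add_one_ne_self hN
  have add_two_ne := add_one_add_one_ne_self hN
  obtain ⟨q, hq⟩ : ∃ q, n + N = q + 1 := ⟨n + N - 1, by omega⟩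
  rw [hq, strand, ← hq, strand_loopGen_add_period hN h, lie_smul, lie_sub, lie_loopGen_matUnit,
    lie_loopGen_matUnit, if_pos rfl, if_neg (by grind), if_neg (by grind), if_pos rfl,
    if_neg (by grind), if_neg (by grind), if_neg (by grind), if_neg (by grind)]
  norm_num

theorem strand_loopGen (hN : 3 ≤ N) (m : ℕ) (i : ZMod N) : strand loopGen i (N * m + 1) =
    upperCoeff N m • matUnit i (i + 1) 1 + lowerCoeff N m • matUnit (i + 1) i (-1) := by
  induction m generalizing i with
  | zero => simp [strand, upperCoeff, lowerCoeff, loopGen]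
  | succ m ih =>
    rw [Nat.mul_succ, strand_loopGen_add_period_add_one hN ih, ← upperCoeff_succ, lowerCoeff_succ]
    module

theorem strand_loopGen_sub_one (hN : 3 ≤ N) (m : ℕ) (i : ZMod N) :
    strand loopGen (i + 1) (N * (m + 1) - 1) =
      (upperCoeff N m * T N) • matUnit (i + 1) i (-1) +
        ((-1) ^ N * lowerCoeff N m * T (-N)) • matUnit i (i + 1) 1 := by
  obtain ⟨s, hs⟩ : ∃ s, N = s + 2 := ⟨N - 2, by omega⟩
  have period : (s : ZMod N) + 2 = 0 := by
    exact_mod_cast (ZMod.natCast_eq_zero_iff (s + 2) N).mpr ⟨1, by omega⟩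
  have end_eq : i + 1 + (s : ZMod N) + 1 = i := by grind
  have length_eq : N * (m + 1) - 1 = N * m + s + 1 := by rw [Nat.mul_succ]; omega
  have degree_eq : (s : ℤ) + 1 = N + -1 := by omega
  have neg_degree_eq : -((N : ℤ) + -1) = -N + 1 := by ring
  have sign_eq : ((-1) ^ s : ℂ[T;T⁻¹]) = (-1) ^ N := by rw [hs, pow_add]; norm_num
  rw [length_eq, strand_loopGen_add (strand_loopGen hN m) (by omega), end_eq, degree_eq,
    neg_degree_eq, sign_eq, ← T_smul_matUnit, ← T_smul_matUnit]
  module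

theorem integral_loopGen_succ (hN : 3 ≤ N) (k : ZMod N → ℂ) (m : ℕ) :
    integral loopGen k (m + 1) = (upperCoeff N m * T N + (-1) ^ N * lowerCoeff N m * T (-N)) •
      hamiltonian loopGen k := by
  rw [integral, if_neg m.succ_ne_zero, hamiltonian, Finset.smul_sum]
  refine Finset.sum_congr rfl fun i _ => ?_
  rw [smul_comm _ (k i), two_smul, strand_loopGen hN, strand_loopGen_sub_one hN, loopGen,
    lowerCoeff_succ, upperCoeff_succ]
  module

/-- The polynomials `P_m` with `I_m = P_m(u) H` in the loop realization, where `u` is `loopU`. -/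
noncomputable def charge (N : ℕ) : ℕ → ℂ[X]
  | 0 => 1
  | 1 => Polynomial.X
  | m + 2 => Polynomial.X ^ m * (Polynomial.X ^ 2 - Polynomial.C (4 * (-1) ^ N))

theorem integral_loopGen (hN : 3 ≤ N) (k : ZMod N → ℂ) (m : ℕ) :
    integral loopGen k m = Polynomial.aeval (loopU N) (charge N m) • hamiltonian loopGen k := by
  rcases m with _ | _ | m
  · simp [integral, charge]
  · simp [integral_loopGen_succ hN, charge, upperCoeff, lowerCoeff, loopU]
  · have T_mul_T_neg : (T N : ℂ[T;T⁻¹]) * T (-N) = 1 := by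
      rw [← LaurentPolynomial.T_add, add_neg_cancel, LaurentPolynomial.T_zero]
    rw [integral_loopGen_succ hN, charge, upperCoeff, lowerCoeff]
    congr 1
    simp only [map_mul, map_sub, map_pow, Polynomial.aeval_X, map_neg, map_one, map_ofNat]
    rw [loopU, loopV]
    linear_combination (-4 * (-1) ^ N * (T N + (-1) ^ N * T (-N)) ^ m) * T_mul_T_neg

theorem lie_integral_loopGen (hN : 3 ≤ N) (k : ZMod N → ℂ) (m n : ℕ) :
    ⁅integral (loopGen (N := N)) k m, integral loopGen k n⁆ = 0 := by
  rw [integral_loopGen hN, integral_loopGen hN, lie_smul, smul_lie, lie_self, smul_zero, smul_zero]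

end LoopIntegrals

section LinearIndependence

/-- The polynomials `charge N m` as a sequence with one polynomial of each degree. -/
noncomputable def chargeSequence (N : ℕ) : Polynomial.Sequence ℂ where
  elems' := charge N
  degree_eq' m := by
    rcases m with _ | _ | m
    · simp [charge]
    · simp [charge]
    · rw [charge, Polynomial.degree_mul, Polynomial.degree_X_pow,
        Polynomial.degree_X_pow_sub_C two_pos]
      rfl

theorem exists_unit_zpow_add_mul_zpow_neg_eq {K : Type*} [Field K] [IsAlgClosed K] {n : ℕ}
    (hn : n ≠ 0) {c : K} (hc : c ≠ 0) (w : K) :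
    ∃ z : Kˣ, ((z ^ (n : ℤ) : Kˣ) : K) + c * ((z ^ (-n : ℤ) : Kˣ) : K) = w := by
  obtain ⟨t, ht⟩ : ∃ t, t ^ 2 - w * t + c = 0 := by
    have degree_eq : (.X ^ 2 - .C w * .X + .C c : K[X]).degree = 2 := by compute_degree!
    obtain ⟨t, ht⟩ := IsAlgClosed.exists_root _ (degree_eq.trans_ne two_ne_zero)
    exact ⟨t, by simpa using ht⟩
  obtain ⟨z, rfl⟩ := IsAlgClosed.exists_pow_nat_eq t (Nat.pos_of_ne_zero hn)
  have pow_ne : z ^ n ≠ 0 := fun h => hc (by simpa [h] using ht)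
  refine ⟨Units.mk0 z (ne_zero_pow hn pow_ne), ?_⟩
  rw [zpow_neg, zpow_natCast, Units.val_inv_eq_inv_val, Units.val_pow_eq_pow_val, Units.val_mk0]
  field_simp
  linear_combination ht

variable {N : ℕ} [NeZero N]

theorem transcendental_loopU : Transcendental ℂ (loopU N) := by
  refine transcendental_iff.mpr fun p hp => Polynomial.funext fun w => ?_
  obtain ⟨z, hz⟩ := exists_unit_zpow_add_mul_zpow_neg_eq (NeZero.ne N)
    (pow_ne_zero N (neg_ne_zero.mpr (one_ne_zero' ℂ))) w
  let evalAt : ℂ[T;T⁻¹] →ₐ[ℂ] ℂ :=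
    { LaurentPolynomial.eval₂ (RingHom.id ℂ) z with
      commutes' := LaurentPolynomial.eval₂_C (RingHom.id ℂ) z }
  have evalAt_T (n : ℤ) : evalAt (T n) = ((z ^ n : ℂˣ) : ℂ) :=
    LaurentPolynomial.eval₂_T (RingHom.id ℂ) z n
  have evalAt_loopU : evalAt (loopU N) = w := by
    rw [loopU, map_add, map_mul, map_pow, map_neg, map_one, evalAt_T, evalAt_T, hz]
  rw [Polynomial.eval_zero, ← evalAt_loopU, ← Polynomial.coe_aeval_eq_eval,
    Polynomial.aeval_algHom_apply, hp, map_zero]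

theorem hamiltonian_loopGen_apply (hN : 3 ≤ N) (k : ZMod N → ℂ) (i : ZMod N) :
    hamiltonian loopGen k i (i + 1) = k i • T 1 := by
  have add_two_ne := add_one_add_one_ne_self hN
  have loopGen_apply (j : ZMod N) : loopGen j i (i + 1) = if j = i then T 1 else 0 := by
    rw [loopGen, Matrix.add_apply, matUnit, matUnit, Matrix.single_apply, Matrix.single_apply,
      if_neg (by grind : ¬ (j + 1 = i ∧ j = i + 1)), add_zero]
    exact if_congr (by grind) rfl rfl
  simp [hamiltonian, Matrix.sum_apply, loopGen_apply]

theorem hamiltonian_loopGen_ne_zero (hN : 3 ≤ N) {k : ZMod N → ℂ} (hk : k ≠ 0) :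
    hamiltonian (loopGen (N := N)) k ≠ 0 := by
  obtain ⟨i, hi⟩ := Function.ne_iff.mp hk
  intro h
  have smul_T_eq := hamiltonian_loopGen_apply hN k i
  rw [h, Matrix.zero_apply, eq_comm, smul_eq_zero] at smul_T_eq
  exact smul_T_eq.elim hi (LaurentPolynomial.isUnit_T 1).ne_zero

theorem linearIndependent_integral_loopGen (hN : 3 ≤ N) {k : ZMod N → ℂ} (hk : k ≠ 0) :
    LinearIndependent ℂ fun m : ℕ => integral (loopGen (N := N)) k m := by
  let smulHamiltonian : ℂ[X] →ₗ[ℂ] LoopMatrix N :=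
    (LinearMap.toSpanSingleton ℂ[T;T⁻¹] (LoopMatrix N) (hamiltonian loopGen k)).restrictScalars ℂ ∘ₗ
      (Polynomial.aeval (loopU N)).toLinearMap
  have ker_eq_bot : LinearMap.ker smulHamiltonian = ⊥ :=
    LinearMap.ker_eq_bot'.mpr fun p hp => transcendental_iff.mp transcendental_loopU p
      ((smul_eq_zero.mp hp).resolve_right (hamiltonian_loopGen_ne_zero hN hk))
  rw [show (fun m : ℕ => integral (loopGen (N := N)) k m) = smulHamiltonian ∘ chargeSequence N from
    funext fun m => integral_loopGen hN k m]
  exact (chargeSequence N).linearIndependent.map' smulHamiltonian ker_eq_bot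

end LinearIndependence

section Presentation

variable {N : ℕ}

/-- The projection from the free Lie algebra onto `A_N`. -/
noncomputable def quotientHom (N : ℕ) : FreeLieAlgebra ℂ (ZMod N) →ₗ⁅ℂ⁆ OnsagerAlgebra N :=
  { (LieSubmodule.Quotient.mk' (relationIdeal N) :
      FreeLieAlgebra ℂ (ZMod N) →ₗ[ℂ] OnsagerAlgebra N) with
    map_lie' := fun {x y} => LieSubmodule.Quotient.mk_bracket (relationIdeal N) x y }

theorem quotientHom_surjective : Function.Surjective (quotientHom N) :=
  LieSubmodule.Quotient.surjective_mk' (relationIdeal N)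

theorem quotientHom_eq_zero {x : FreeLieAlgebra ℂ (ZMod N)} (hx : x ∈ relators N) :
    quotientHom N x = 0 :=
  LieSubmodule.Quotient.mk_eq_zero'.mpr (LieSubmodule.subset_lieSpan hx)

theorem dolanGrady_gen : DolanGrady (gen (N := N)) where
  adjacent i j h := by
    have relator_eq_zero := quotientHom_eq_zero (N := N) (Or.inl ⟨i, j, h, rfl⟩)
    rw [map_sub, LieHom.map_lie, LieHom.map_lie] at relator_eq_zero
    exact sub_eq_zero.mp relator_eq_zero
  not_adjacent i j h := by
    have relator_eq_zero := quotientHom_eq_zero (N := N) (Or.inr ⟨i, j, h, rfl⟩)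
    rwa [LieHom.map_lie] at relator_eq_zero

theorem lieSpan_range_gen :
    LieSubalgebra.lieSpan ℂ (OnsagerAlgebra N) (Set.range gen) = ⊤ := by
  set K := LieSubalgebra.lieSpan ℂ (OnsagerAlgebra N) (Set.range gen)
  let liftToK : FreeLieAlgebra ℂ (ZMod N) →ₗ⁅ℂ⁆ K := FreeLieAlgebra.lift ℂ fun i =>
    ⟨gen i, LieSubalgebra.subset_lieSpan (Set.mem_range_self i)⟩
  have incl_comp_liftToK : K.incl.comp liftToK = quotientHom N := by
    refine FreeLieAlgebra.hom_ext fun i => ?_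
    rw [LieHom.comp_apply, FreeLieAlgebra.lift_of_apply]
    rfl
  refine eq_top_iff.mpr fun x _ => ?_
  obtain ⟨y, rfl⟩ := quotientHom_surjective x
  rw [← incl_comp_liftToK]
  exact (liftToK y).2

variable {L : Type*} [LieRing L] [LieAlgebra ℂ L] {e : ZMod N → L}

theorem exists_lieHom_gen_eq (he : DolanGrady e) :
    ∃ f : OnsagerAlgebra N →ₗ⁅ℂ⁆ L, ∀ i, f (gen i) = e i := by
  let F : FreeLieAlgebra ℂ (ZMod N) →ₗ⁅ℂ⁆ L := FreeLieAlgebra.lift ℂ e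
  have map_letter (i : ZMod N) : F (letter i) = e i := FreeLieAlgebra.lift_of_apply ..
  have relationIdeal_le : relationIdeal N ≤ F.ker := by
    refine LieSubmodule.lieSpan_le.mpr ?_
    rintro x (⟨i, j, h, rfl⟩ | ⟨i, j, h, rfl⟩)
    · simp [LieHom.mem_ker, map_letter, he.adjacent i j h]
    · simp [LieHom.mem_ker, map_letter, he.not_adjacent i j h]
  let f : OnsagerAlgebra N →ₗ[ℂ] L := (relationIdeal N).toSubmodule.liftQ
    (F : FreeLieAlgebra ℂ (ZMod N) →ₗ[ℂ] L) fun _ hx => relationIdeal_le hx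
  refine ⟨{ f with map_lie' := fun {x y} => ?_ }, map_letter⟩
  obtain ⟨x, rfl⟩ := quotientHom_surjective x
  obtain ⟨y, rfl⟩ := quotientHom_surjective y
  exact F.map_lie x y

variable {L' : Type*} [LieRing L'] [LieAlgebra ℂ L'] {e' : ZMod N → L'}

theorem map_strand (f : L →ₗ⁅ℂ⁆ L') (hf : ∀ i, f (e i) = e' i) (r : ℕ) (i : ZMod N) :
    f (strand e i r) = strand e' i r := by
  rcases r with _ | n
  · rw [strand, strand, map_zero]
  induction n generalizing i with
  | zero => rw [zero_add, strand, strand, hf]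
  | succ n ih => rw [strand, strand, LieHom.map_lie, hf, ih]

theorem map_integral [NeZero N] (f : L →ₗ⁅ℂ⁆ L') (hf : ∀ i, f (e i) = e' i) (k : ZMod N → ℂ)
    (m : ℕ) : f (integral e k m) = integral e' k m := by
  rw [integral, integral, hamiltonian, hamiltonian]
  split_ifs <;> simp only [map_sum, map_smul, map_add, hf, map_strand f hf]

variable [NeZero N]

theorem lie_integral_gen (hN : 3 ≤ N) (k : ZMod N → ℂ) (m n : ℕ) :
    ⁅integral (gen (N := N)) k m, integral gen k n⁆ = 0 := by
  obtain ⟨f, hf⟩ := exists_lieHom_gen_eq (dolanGrady_loopGen hN)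
  apply injective_of_map_eq_loopGen hN dolanGrady_gen lieSpan_range_gen f hf
  rw [LieHom.map_lie, map_integral f hf, map_integral f hf, lie_integral_loopGen hN, map_zero]

theorem DolanGrady.lie_integral (hN : 3 ≤ N) (he : DolanGrady e) (k : ZMod N → ℂ) (m n : ℕ) :
    ⁅integral e k m, integral e k n⁆ = 0 := by
  obtain ⟨f, hf⟩ := exists_lieHom_gen_eq he
  rw [← map_integral f hf, ← map_integral f hf, ← LieHom.map_lie, lie_integral_gen hN, map_zero]

theorem linearIndependent_integral_gen (hN : 3 ≤ N) {k : ZMod N → ℂ} (hk : k ≠ 0) :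
    LinearIndependent ℂ fun m : ℕ => integral (gen (N := N)) k m := by
  obtain ⟨f, hf⟩ := exists_lieHom_gen_eq (dolanGrady_loopGen hN)
  refine LinearIndependent.of_comp (f : OnsagerAlgebra N →ₗ[ℂ] LoopMatrix N) ?_
  have linearIndependent_map := linearIndependent_integral_loopGen hN hk
  rw [← funext fun m => map_integral f hf k m] at linearIndependent_map
  exact linearIndependent_map

end Presentation

end SlOnsager

theorem mainTheorem6 (N : ℕ) [NeZero N] (hN : 3 ≤ N) (k : ZMod N → ℂ) :
    (∀ m n : ℕ, ⁅SlOnsager.integral (L := SlOnsager.OnsagerAlgebra N) SlOnsager.gen k m,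
        SlOnsager.integral (L := SlOnsager.OnsagerAlgebra N) SlOnsager.gen k n⁆ = 0) ∧
    (∀ (V : Type*) [AddCommGroup V] [Module ℂ V] (e : ZMod N → Module.End ℂ V),
        SlOnsager.DolanGrady e →
        ∀ m n : ℕ, Commute (SlOnsager.integral e k m) (SlOnsager.integral e k n)) ∧
    (k ≠ 0 → LinearIndependent ℂ
      (fun m : ℕ => SlOnsager.integral (L := SlOnsager.OnsagerAlgebra N) SlOnsager.gen k m)) := by
  refine ⟨SlOnsager.lie_integral_gen hN k, fun V _ _ e he m n => ?_,
    SlOnsager.linearIndependent_integral_gen hN⟩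
  exact commute_iff_lie_eq.mpr (he.lie_integral hN k m n)
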